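/- Let $(R,\mathfrak m,k)$ be a one-dimensional Noetherian local domain with infinite residue field $k$ and quotient field $K$. Assume that the integral closure $\overline R$ of $R$ in $K$ is a finite $R$-module and a discrete valuation ring, and that the natural map from $k$ to the residue field of $\overline R$ is an isomorphism. For $R$-submodules $A,B$ of $K$ put $A:B=\{x\in K \mid xB\subseteq A\}$ and $A^{**}=R:(R:A)$. Let $\omega$ be a canonical module of $R$ (that is, a finitely generated $R$-module with $\operatorname{Ext}^1_R(k,\omega)\cong k$ and $\operatorname{Ext}^i_R(k,\omega)=0$ for $i\neq 1$), chosen as an $R$-submodule of $K$ with $R\subseteq\omega\subseteq\overline R$. Let $I$ be an $\mathfrak m$-primary ideal of $R$ which is not principal, let $\Lambda=\bigcup_{n\ge 0}(I^n:I^n)$ be the blowing-up of $R$ along $I$, and let $\nu$ be the reduction exponent of $I$, i.e. the least integer $m$ such that for some $x\in I$ one has $I^{n+1}=xI^n$ for all $n\ge m$. For an ideal $J$ of $R$ let $\widetilde J=J\omega\cap R$ be its canonical closure. Then: (A) The following conditions are equivalent: $(A_1)$ $\omega\subseteq\Lambda$; $(A_2)$ $\omega\Lambda=\Lambda$; $(A_3)$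 $\omega:\Lambda=R:\Lambda$; $(A_4)$ $I^n=\widetilde{I^n}$ for all $n\ge\nu$; $(A_5)$ $\omega I^n=I^n$ for all $n\ge\nu$; $(A_6)$ there exists $n>0$ such that $\omega I^n=I^n$. (B) The following conditions are equivalent: $(B_1)$ $\Lambda=\Lambda^{**}$; $(B_2)$ $\omega:\Lambda=\omega(R:\Lambda)$. Moreover, the conditions (A) hold if and only if the conditions (B) hold and $R:\Lambda\subseteq R:\omega$. -/

import Mathlib

universe u

noncomputable section

/-- A canonical module of a Noetherian (Cohen-Macaulay) local ring `(R, 𝔪, k)` of dimension `d`: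
a finitely generated module `M` with `Extⁱ(k, M) ≅ k` for `i = d` and `Extⁱ(k, M) = 0` for
`i ≠ d`. -/
structure IsCanonicalModule (R : Type u) [CommRing R] [IsLocalRing R]
    (M : Type u) [AddCommGroup M] [Module R M] : Prop where
  finite : Module.Finite R M
  ext_dim : ∀ i : ℕ, (i : WithBot ℕ∞) = ringKrullDim R →
    Nonempty (CategoryTheory.Abelian.Ext (ModuleCat.of R (IsLocalRing.ResidueField R))
      (ModuleCat.of R M) i ≃ₗ[R] IsLocalRing.ResidueField R)
  ext_ne_dim : ∀ i : ℕ, (i : WithBot ℕ∞) ≠ ringKrullDim R →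
    Subsingleton (CategoryTheory.Abelian.Ext (ModuleCat.of R (IsLocalRing.ResidueField R))
      (ModuleCat.of R M) i)

/-- Residual rationality of `R` inside a local `R`-algebra `S`: the natural map from `R`, hence
from the residue field of `R`, onto the residue field of `S` is surjective. -/
def IsResiduallyRational (R S : Type*) [CommRing R] [CommRing S] [IsLocalRing S]
    [Algebra R S] : Prop :=
  Function.Surjective ((IsLocalRing.residue S).comp (algebraMap R S))

section Blowup

variable {R : Type*} [CommRing R] (K : Type*) [Field K] [Algebra R K]

open IsLocalization (coeSubmodule)

/-- The blowing-up `Λ(I) = ⋃ₙ (Iⁿ : Iⁿ)`, as an `R`-submodule of `K`. Here, for submodules of `K`,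
`A / B` is the colon `A : B = {x ∈ K | x B ⊆ A}`. The supremum is the union, see
`mem_blowup_iff`. -/
def blowup (I : Ideal R) : Submodule R K :=
  ⨆ n : ℕ, coeSubmodule K (I ^ n) / coeSubmodule K (I ^ n)

theorem mem_blowup_iff (I : Ideal R) (z : K) :
    z ∈ blowup K I ↔ ∃ n : ℕ, z ∈ coeSubmodule K (I ^ n) / coeSubmodule K (I ^ n) := by
  have hmono : Monotone fun n : ℕ => coeSubmodule K (I ^ n) / coeSubmodule K (I ^ n) := by
    refine monotone_nat_of_le_succ fun n z hz => ?_
    rw [Submodule.mem_div_iff_forall_mul_mem] at hz ⊢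
    intro y hy
    rw [pow_succ, IsLocalization.coeSubmodule_mul] at hy ⊢
    refine Submodule.mul_induction_on hy (fun a ha b hb => ?_) fun a b ha hb => ?_
    · rw [← mul_assoc]
      exact Submodule.mul_mem_mul (hz a ha) hb
    · rw [mul_add]
      exact add_mem ha hb
  exact Submodule.mem_iSup_of_directed _ hmono.directed_le

/-- The canonical closure `J ω ∩ R` of an ideal `J` of `R`, as an ideal of `R`. -/
def canonicalClosure (ω : Submodule R K) (J : Ideal R) : Ideal R :=
  (coeSubmodule K J * ω).comap (Algebra.linearMap R K)

end Blowup

/-- The reduction exponent `ν(I)`: the least `m` such that, for a minimal reduction `x ∈ I`,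
`Iⁿ⁺¹ = x Iⁿ` for all `n ≥ m`. It does not depend on `x`, see `reductionExponent_eq`. -/
def reductionExponent {R : Type*} [CommRing R] (I : Ideal R) : ℕ :=
  sInf {m : ℕ | ∃ x ∈ I, ∀ n ≥ m, I ^ (n + 1) = Ideal.span {x} * I ^ n}

/-- Any minimal reduction `x` of `I` computes the reduction exponent. -/
theorem reductionExponent_eq {R : Type*} [CommRing R] [IsDomain R] {I : Ideal R} (hI : I ≠ ⊥)
    {x : R} (hx : x ∈ I) (hred : ∃ N, ∀ n ≥ N, I ^ (n + 1) = Ideal.span {x} * I ^ n) :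
    reductionExponent I = sInf {m : ℕ | ∀ n ≥ m, I ^ (n + 1) = Ideal.span {x} * I ^ n} := by
  unfold reductionExponent
  congr 1
  ext m
  refine ⟨?_, fun h => ⟨x, hx, h⟩⟩
  rintro ⟨y, -, hym⟩ n hn
  obtain ⟨N, hN⟩ := hred
  have hy0 : y ≠ 0 := by
    rintro rfl
    have h := hym m le_rfl
    rw [Ideal.span_singleton_zero, Ideal.bot_mul] at h
    exact hI (eq_bot_iff.2 (pow_eq_zero_iff (Nat.succ_ne_zero m) |>.1 h).le)
  have key : ∀ j k, m ≤ k → I ^ (k + j) = Ideal.span {y ^ j} * I ^ k := by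
    intro j k hk
    induction j with
    | zero => simp
    | succ j ih =>
      rw [← add_assoc, hym _ (by omega), ih, ← mul_assoc, Ideal.span_singleton_mul_span_singleton,
        ← pow_succ']
  have h := hN (n + N) (by omega)
  rw [show n + N + 1 = (n + 1) + N by ring, key N (n + 1) (by omega), key N n hn, ← mul_assoc,
    mul_comm (Ideal.span {x}), mul_assoc] at h
  exact (Ideal.span_singleton_mul_right_inj (pow_ne_zero N hy0)).1 h

end

/-!
Multiplication by `f ∈ ω : 𝔪` identifies `(ω : 𝔪) / ω` with a submodule of `Ext¹(k, ω) ≅ k`, so the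
colon `ω : -` turns an inclusion with simple or zero quotient into another one. Applying it twice
along a chain of such steps from `s ω` to a fractional ideal `A` cannot increase the length, which
forces the inclusion `A ⊆ ω : (ω : A)` to be an equality.

As `R̄` is a valuation ring, `I R̄ = x R̄` for some `x ∈ I`. The powers of `x⁻¹ I` then increase
inside the finite `R`-module `R̄`, hence stabilize, and their union is `Λ`. So `Λ` is a fractional
ideal closed under multiplication with `I ^ n = x ^ n Λ` for all `n ≥ ν`, and everything reduces to
formal computations with colons, invertible factors `x ^ n` and the duality.
-/

open IsLocalRing
open IsLocalization (coeSubmodule)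

section Colon

variable {R S : Type*} [CommSemiring R] [CommSemiring S] [Algebra R S]

theorem colon_le_colon_left (A : Submodule R S) {B C : Submodule R S} (h : B ≤ C) :
    A / C ≤ A / B :=
  Submodule.le_div_iff.2 fun _ hz y hy => Submodule.mem_div_iff_forall_mul_mem.1 hz y (h hy)

theorem colon_le_colon_right {A B : Submodule R S} (h : A ≤ B) (C : Submodule R S) :
    A / C ≤ B / C :=
  Submodule.le_div_iff_mul_le.2 ((Submodule.le_div_iff_mul_le.1 le_rfl).trans h)

theorem le_colon_colon (A B : Submodule R S) : B ≤ A / (A / B) := by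
  rw [Submodule.le_div_iff_mul_le, mul_comm, ← Submodule.le_div_iff_mul_le]

theorem colon_one (A : Submodule R S) : A / 1 = A :=
  eq_of_forall_le_iff fun D => by rw [Submodule.le_div_iff_mul_le, mul_one]

theorem colon_mul (A B C : Submodule R S) : A / (B * C) = A / B / C :=
  eq_of_forall_le_iff fun D => by
    simp only [Submodule.le_div_iff_mul_le, mul_assoc, mul_comm B C]

theorem colon_sup (A B C : Submodule R S) : A / (B ⊔ C) = A / B ⊓ A / C :=
  eq_of_forall_le_iff fun D => by
    simp only [le_inf_iff, Submodule.le_div_iff_mul_le, Submodule.mul_sup, sup_le_iff]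

theorem mem_colon_span_singleton {A : Submodule R S} {b z : S} :
    z ∈ A / Submodule.span R {b} ↔ z * b ∈ A := by
  rw [← Submodule.span_singleton_le_iff_mem, Submodule.le_div_iff_mul_le, Submodule.span_mul_span,
    Set.singleton_mul_singleton, Submodule.span_singleton_le_iff_mem]

theorem span_singleton_mul_le_iff {A B : Submodule R S} {a : S} :
    Submodule.span R {a} * A ≤ B ↔ ∀ z ∈ A, a * z ∈ B := by
  simp only [SetLike.le_def, Submodule.mem_span_singleton_mul, forall_exists_index, and_imp,
    forall_apply_eq_imp_iff₂]

theorem colon_units_mul (A B : Submodule R S) (U : (Submodule R S)ˣ) :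
    A / (U * B) = ↑U⁻¹ * (A / B) := by
  refine (eq_of_forall_le_iff fun D => ?_).symm
  rw [← U.isUnit.mul_le_mul_left, Units.mul_inv_cancel_left, Submodule.le_div_iff_mul_le,
    Submodule.le_div_iff_mul_le, mul_left_comm, ← mul_assoc]

theorem mul_colon_mul_of_isUnit {U : Submodule R S} (hU : IsUnit U) (A B : Submodule R S) :
    U * A / (U * B) = A / B := by
  refine eq_of_forall_le_iff fun D => ?_
  rw [Submodule.le_div_iff_mul_le, Submodule.le_div_iff_mul_le, mul_left_comm,
    hU.mul_le_mul_left]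

theorem colon_self_colon_self (A : Submodule R S) : A / (A / A) = A := by
  refine le_antisymm (fun z hz => ?_) (le_colon_colon A A)
  simpa only [mul_one] using
    Submodule.mem_div_iff_forall_mul_mem.1 hz 1 (Submodule.one_mem_div.2 le_rfl)

theorem colon_le_self {A B : Submodule R S} (h : 1 ≤ B) : A / B ≤ A :=
  (colon_le_colon_left A h).trans_eq (colon_one A)

theorem le_iff_mul_eq_self {A B : Submodule R S} (hA : 1 ≤ A) (hB : 1 ≤ B) (hBB : B * B ≤ B) :
    A ≤ B ↔ A * B = B := by
  constructor
  · exact fun h => le_antisymm ((mul_le_mul_left h B).trans hBB) (le_mul_of_one_le_left' hA)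
  · exact fun h => (le_mul_of_one_le_right' hB).trans_eq h

theorem fg_one : (1 : Submodule R S).FG :=
  Submodule.one_eq_span (R := R) (A := S) ▸ Submodule.fg_span_singleton 1

theorem span_singleton_mul_span_singleton_inv (R : Type*) {K : Type*} [CommSemiring R] [Semifield K]
    [Algebra R K] {a : K} (ha : a ≠ 0) :
    Submodule.span R {a} * Submodule.span R {a⁻¹} = 1 := by
  rw [Submodule.span_mul_span, Set.singleton_mul_singleton, mul_inv_cancel₀ ha,
    Submodule.one_eq_span]

theorem isUnit_span_singleton (R : Type*) {K : Type*} [CommSemiring R] [Semifield K] [Algebra R K]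
    {a : K} (ha : a ≠ 0) : IsUnit (Submodule.span R {a}) :=
  .of_mul_eq_one _ (span_singleton_mul_span_singleton_inv R ha)

end Colon

section FractionalIdeals

variable {R K : Type*} [CommRing R] [Field K] [Algebra R K]

theorem fg_colon [IsNoetherianRing R] {A B : Submodule R K} (hA : A.FG) (hB : B ≠ ⊥) :
    (A / B).FG := by
  obtain ⟨b, hbB, hb0⟩ := B.exists_mem_ne_zero_of_ne_bot hB
  refine ((Submodule.fg_span_singleton b⁻¹).mul hA).of_le fun z hz => ?_
  exact Submodule.mem_span_singleton_mul.2
    ⟨z * b, Submodule.mem_div_iff_forall_mul_mem.1 hz b hbB, by field_simp⟩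

variable [IsFractionRing R K]

theorem exists_span_singleton_mul_le {A B : Submodule R K} (hA : A.FG) (hB : B ≠ ⊥) :
    ∃ s : R, s ≠ 0 ∧ Submodule.span R {algebraMap R K s} * A ≤ B := by
  have : Nontrivial R := (algebraMap R K).domain_nontrivial
  obtain ⟨b, hbB, hb0⟩ := B.exists_mem_ne_zero_of_ne_bot hB
  obtain ⟨s, hs, hsA⟩ := FractionalIdeal.isFractional_of_fg (S := nonZeroDivisors R)
    ((Submodule.fg_span_singleton b⁻¹).mul hA)
  refine ⟨s, nonZeroDivisors.ne_zero hs, fun z hz => ?_⟩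
  obtain ⟨w, hw, rfl⟩ := Submodule.mem_span_singleton_mul.1 hz
  obtain ⟨r, hr⟩ := hsA (b⁻¹ * w)
    (Submodule.mul_mem_mul (Submodule.mem_span_singleton_self _) hw)
  have hrb : algebraMap R K s * w = r • b := by
    rw [Algebra.smul_def, hr, Algebra.smul_def]
    field_simp
  exact hrb ▸ B.smul_mem r hbB

theorem one_colon_ne_bot {A : Submodule R K} (hA : A.FG) : 1 / A ≠ ⊥ := by
  obtain ⟨s, hs0, hs⟩ := exists_span_singleton_mul_le hA (one_ne_zero (α := Submodule R K))
  rw [← Submodule.le_div_iff_mul_le, Submodule.span_singleton_le_iff_mem] at hs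
  exact (Submodule.ne_bot_iff _).2 ⟨_, hs, by simpa using hs0⟩

end FractionalIdeals

/-- A submodule `ω` of `K` is dualizing if `ω : (ω : A) = A` for every nonzero finitely generated
submodule `A` of `K`: the property of a canonical ideal by which `ω : -` is a duality of fractional
ideals. -/
def IsDualizing {R K : Type*} [CommRing R] [Field K] [Algebra R K] (ω : Submodule R K) : Prop :=
  ∀ ⦃A : Submodule R K⦄, A ≠ ⊥ → A.FG → ω / (ω / A) = A

namespace IsDualizing

variable {R K : Type*} [CommRing R] [Field K] [Algebra R K] {ω A Λ : Submodule R K}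

theorem colon_mul (h : IsDualizing ω) (A : Submodule R K) : ω / (ω * A) = 1 / A := by
  have hωω : ω / ω = 1 := by
    simpa only [colon_one] using h (A := 1) one_ne_zero fg_one
  rw [_root_.colon_mul, hωω]

theorem eq_one_colon_one_colon_iff [IsNoetherianRing R] [IsFractionRing R K] (h : IsDualizing ω)
    (hω : ω.FG) (hω0 : ω ≠ ⊥) (hA : A.FG) (hA0 : A ≠ ⊥) :
    A = 1 / (1 / A) ↔ ω / A = ω * (1 / A) := by
  have h1A : (1 / A).FG := fg_colon fg_one hA0
  have hωA : ω / (ω / (ω * (1 / A))) = ω * (1 / A) :=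
    h (mul_ne_zero hω0 (one_colon_ne_bot hA)) (hω.mul h1A)
  rw [h.colon_mul] at hωA
  constructor
  · intro hAA
    rwa [← hAA] at hωA
  · intro hAω
    rw [← h.colon_mul, ← hAω, h hA0 hA]

theorem le_iff_colon_eq_one_colon (h : IsDualizing ω) (hω : 1 ≤ ω) (hΛ : Λ.FG) (h1Λ : 1 ≤ Λ)
    (hΛΛ : Λ * Λ ≤ Λ) : ω ≤ Λ ↔ ω / Λ = 1 / Λ := by
  constructor
  · intro hle
    rw [← h.colon_mul, (le_iff_mul_eq_self hω h1Λ hΛΛ).1 hle]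
  · intro heq
    rw [← h (ne_bot_of_le_ne_bot one_ne_zero h1Λ) hΛ, heq, Submodule.le_div_iff_mul_le]
    exact mul_le_of_le_one_right' (colon_le_self h1Λ)

theorem le_iff_eq_one_colon_one_colon_and_le (h : IsDualizing ω) (hω : 1 ≤ ω) (hΛ : Λ.FG)
    (h1Λ : 1 ≤ Λ) (hΛΛ : Λ * Λ ≤ Λ) :
    ω ≤ Λ ↔ Λ = 1 / (1 / Λ) ∧ 1 / Λ ≤ 1 / ω := by
  constructor
  · refine fun hle => ⟨le_antisymm (le_colon_colon 1 Λ) ?_, colon_le_colon_left 1 hle⟩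
    calc 1 / (1 / Λ) ≤ ω / (1 / Λ) := colon_le_colon_right hω _
      _ = ω / (ω / Λ) := by rw [(h.le_iff_colon_eq_one_colon hω hΛ h1Λ hΛΛ).1 hle]
      _ = Λ := h (ne_bot_of_le_ne_bot one_ne_zero h1Λ) hΛ
  · rintro ⟨hΛ, hle⟩
    rw [hΛ]
    exact (le_colon_colon 1 ω).trans (colon_le_colon_left 1 hle)

end IsDualizing

section LocalRing

variable {R M : Type*} [CommRing R] [IsLocalRing R] [AddCommGroup M] [Module R M]
  {A B : Submodule R M}

theorem wcovBy_sup_span_singleton {b : M} (hb : ∀ a ∈ maximalIdeal R, a • b ∈ A) :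
    A ⩿ A ⊔ Submodule.span R {b} := by
  refine ⟨le_sup_left, fun C hAC hCB => hCB.not_ge (sup_le hAC.le ?_)⟩
  obtain ⟨z, hzC, hzA⟩ := SetLike.exists_of_lt hAC
  obtain ⟨y, hy, _, hrb, rfl⟩ := Submodule.mem_sup.1 (hCB.le hzC)
  obtain ⟨r, rfl⟩ := Submodule.mem_span_singleton.1 hrb
  have hr : IsUnit r := by
    by_contra hr
    exact hzA (add_mem hy (hb r hr))
  rw [Submodule.span_singleton_le_iff_mem, ← C.smul_mem_iff_of_isUnit hr]
  exact (add_mem_cancel_left (hAC.le hy)).1 hzC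

theorem exists_eq_sup_span_singleton_of_wcovBy (h : A ⩿ B) :
    ∃ b, (∀ a ∈ maximalIdeal R, a • b ∈ A) ∧ B = A ⊔ Submodule.span R {b} := by
  by_cases hBA : B ≤ A
  · exact ⟨0, by simp, by simpa using hBA.antisymm h.le⟩
  have hgen : ∀ z ∈ B, z ∉ A → A ⊔ Submodule.span R {z} = B := fun z hzB hzA =>
    (h.eq_or_eq le_sup_left (sup_le h.le (by simpa using hzB))).resolve_left
      fun heq => hzA (by simpa using heq)
  obtain ⟨b, hbB, hbA⟩ := SetLike.not_le_iff_exists.1 hBA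
  refine ⟨b, fun a ha => ?_, (hgen b hbB hbA).symm⟩
  by_contra hab
  obtain ⟨y, hy, _, hrb, hyb⟩ := Submodule.mem_sup.1 ((hgen _ (B.smul_mem a hbB) hab).ge hbB)
  obtain ⟨r, rfl⟩ := Submodule.mem_span_singleton.1 hrb
  have hunit : IsUnit (1 - r * a) :=
    isUnit_one_sub_self_of_mem_nonunits _ (Ideal.mul_mem_left _ r ha)
  have hyb' : (1 - r * a) • b = y := by
    rw [sub_smul, one_smul, mul_smul, sub_eq_iff_eq_add, hyb]
  exact hbA ((A.smul_mem_iff_of_isUnit hunit).1 (hyb' ▸ hy))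

theorem reflTransGen_wcovBy_sup_of_maximalIdeal_smul_le {C : Submodule R M} (hC : C.FG)
    (h : maximalIdeal R • C ≤ A) : Relation.ReflTransGen (· ⩿ ·) A (A ⊔ C) := by
  induction C, hC using Submodule.fg_induction generalizing A with
  | singleton b =>
    exact .single (wcovBy_sup_span_singleton fun a ha =>
      h (Submodule.smul_mem_smul ha (Submodule.mem_span_singleton_self b)))
  | sup C D _ _ hC hD =>
    rw [Submodule.smul_sup, sup_le_iff] at h
    rw [← sup_assoc]
    exact (hC h.1).trans (hD (h.2.trans le_sup_left))

theorem reflTransGen_wcovBy_of_maximalIdeal_pow_smul_le [IsNoetherianRing R] (hB : B.FG)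
    (hAB : A ≤ B) {n : ℕ} (h : maximalIdeal R ^ n • B ≤ A) :
    Relation.ReflTransGen (· ⩿ ·) A B := by
  induction n generalizing A with
  | zero =>
    rw [pow_zero, one_smul] at h
    rw [hAB.antisymm h]
  | succ n ih =>
    have hfg : (maximalIdeal R ^ n • B).FG := Submodule.FG.smul (IsNoetherian.noetherian _) hB
    rw [pow_succ', mul_smul] at h
    exact (reflTransGen_wcovBy_sup_of_maximalIdeal_smul_le hfg h).trans
      (ih (sup_le hAB Submodule.smul_le_right) le_sup_right)

end LocalRing

section CanonicalModule

open CategoryTheory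

theorem exists_comp_eq_of_extClass_comp_eq_zero {C : Type*} [Category* C] [Abelian C] [HasExt C]
    {S : ShortComplex C} (hS : S.ShortExact) {Y : C} (f : S.X₁ ⟶ Y)
    (hf : hS.extClass.comp (Abelian.Ext.mk₀ f) (add_zero 1) = 0) : ∃ g : S.X₂ ⟶ Y, S.f ≫ g = f := by
  obtain ⟨x, hx⟩ := Abelian.Ext.contravariant_sequence_exact₁ hS _ _ (add_zero 1) hf
  obtain ⟨g, rfl⟩ := Abelian.Ext.homEquiv₀.symm.surjective x
  rw [Abelian.Ext.homEquiv₀_symm_apply, Abelian.Ext.mk₀_comp_mk₀] at hx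
  exact ⟨g, Abelian.Ext.homEquiv₀.symm.injective hx⟩

/-- Since `R` is projective, `Ext¹(k, M)` is the cokernel of `Hom(R, M) → Hom(𝔪, M)`; if it is
one-dimensional over `k`, then any class which is not zero spans it. -/
theorem exists_extension_sub_smul {R M : Type u} [CommRing R] [IsLocalRing R]
    [AddCommGroup M] [Module R M]
    (e : Abelian.Ext (ModuleCat.of R (ResidueField R)) (ModuleCat.of R M) 1 ≃ₗ[R] ResidueField R)
    {φ : maximalIdeal R →ₗ[R] M} (hφ : ¬ ∃ φ' : R →ₗ[R] M, φ' ∘ₗ (maximalIdeal R).subtype = φ)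
    (ψ : maximalIdeal R →ₗ[R] M) :
    ∃ (r : R) (ψ' : R →ₗ[R] M), ψ' ∘ₗ (maximalIdeal R).subtype = ψ - r • φ := by
  let S : ShortComplex (ModuleCat.{u} R) :=
    ModuleCat.shortComplexOfCompEqZero (maximalIdeal R).subtype
      (Algebra.linearMap R (ResidueField R)) (by ext a; simp)
  have hS : S.ShortExact :=
    ModuleCat.shortComplex_shortExact S (fun a => by simp [S]) (Submodule.injective_subtype _)
      residue_surjective
  let δ : (maximalIdeal R →ₗ[R] M) →ₗ[R] ResidueField R :=
    { toFun χ := e (hS.extClass.comp (Abelian.Ext.mk₀ (ModuleCat.ofHom χ)) (add_zero 1))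
      map_add' χ χ' := by
        rw [ModuleCat.ofHom_add, Abelian.Ext.mk₀_add, Abelian.Ext.comp_add, map_add]
      map_smul' r χ := by
        have hsmul : ModuleCat.ofHom (r • χ) = r • ModuleCat.ofHom χ := rfl
        rw [hsmul, Abelian.Ext.mk₀_smul, Abelian.Ext.comp_smul, map_smul, RingHom.id_apply] }
  have extends_of_δ_eq_zero {χ : maximalIdeal R →ₗ[R] M} (hχ : δ χ = 0) :
      ∃ χ' : R →ₗ[R] M, χ' ∘ₗ (maximalIdeal R).subtype = χ := by
    obtain ⟨g, hg⟩ := exists_comp_eq_of_extClass_comp_eq_zero hS _ (e.map_eq_zero_iff.1 hχ)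
    exact ⟨g.hom, congrArg ModuleCat.Hom.hom hg⟩
  have hδφ : δ φ ≠ 0 := fun h => hφ (extends_of_δ_eq_zero h)
  obtain ⟨r, hr⟩ := residue_surjective (δ ψ / δ φ)
  refine ⟨r, extends_of_δ_eq_zero ?_⟩
  rw [map_sub, map_smul, Algebra.smul_def, ResidueField.algebraMap_eq, hr,
    div_mul_cancel₀ _ hδφ, sub_self]

theorem maximalIdeal_ne_bot_of_ringKrullDim_eq_one {R : Type*} [CommRing R] [IsLocalRing R]
    (hdim : ringKrullDim R = 1) : maximalIdeal R ≠ ⊥ := fun h =>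
  zero_ne_one ((ringKrullDim_eq_zero_of_isField (isField_iff_maximalIdeal_eq.2 h)).symm.trans hdim)

theorem exists_maximalIdeal_pow_le {R : Type*} [CommRing R] [IsDomain R] [IsLocalRing R]
    [IsNoetherianRing R] [Ring.KrullDimLE 1 R] {J : Ideal R} (hJ : J ≠ ⊥) :
    ∃ n, maximalIdeal R ^ n ≤ J := by
  refine Ideal.exists_pow_le_of_le_radical_of_fg ?_ (IsNoetherian.noetherian _)
  rw [Ideal.radical_eq_sInf]
  refine le_sInf fun P ⟨hJP, hP⟩ => ?_
  have hPmax := Ring.krullDimLE_one_iff_of_noZeroDivisors.1 ‹_› P (ne_bot_of_le_ne_bot hJ hJP) hP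
  exact (eq_maximalIdeal hPmax).ge

theorem exists_maximalIdeal_pow_smul_le {R K : Type*} [CommRing R] [IsDomain R] [IsLocalRing R]
    [IsNoetherianRing R] [Ring.KrullDimLE 1 R] [Field K] [Algebra R K] [IsFractionRing R K]
    {A B : Submodule R K} (hA : A.FG) (hB : B ≠ ⊥) : ∃ n, maximalIdeal R ^ n • A ≤ B := by
  obtain ⟨s, hs0, hs⟩ := exists_span_singleton_mul_le hA hB
  obtain ⟨n, hn⟩ := exists_maximalIdeal_pow_le (J := Ideal.span {s}) (by simpa using hs0)
  refine ⟨n, Submodule.smul_le.2 fun c hc z hz => ?_⟩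
  obtain ⟨d, rfl⟩ := Ideal.mem_span_singleton'.1 (hn hc)
  rw [mul_smul]
  refine B.smul_mem d (hs ?_)
  rw [Algebra.smul_def]
  exact Submodule.mul_mem_mul (Submodule.mem_span_singleton_self _) hz

variable {R K : Type u} [CommRing R] [IsLocalRing R] [Field K] [Algebra R K]
  [IsFractionRing R K] {ω A B : Submodule R K}

namespace IsCanonicalModule

theorem exists_sub_smul_mem (hω : IsCanonicalModule R ω) (hdim : ringKrullDim R = 1) {f g : K}
    (hf : ∀ a ∈ maximalIdeal R, a • f ∈ ω) (hg : ∀ a ∈ maximalIdeal R, a • g ∈ ω) (hfω : f ∉ ω) :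
    ∃ r : R, g - r • f ∈ ω := by
  obtain ⟨e⟩ := hω.ext_dim 1 (by rw [hdim, Nat.cast_one])
  obtain ⟨b, hb, hb0⟩ := Submodule.exists_mem_ne_zero_of_ne_bot
    (maximalIdeal_ne_bot_of_ringKrullDim_eq_one hdim)
  let mulRight (z : K) (hz : ∀ a ∈ maximalIdeal R, a • z ∈ ω) : maximalIdeal R →ₗ[R] ω :=
    (LinearMap.toSpanSingleton R K z).restrict hz
  have mem_of_extension (χ : R →ₗ[R] ω) (z : K) (h : (χ b : K) = b • z) : z ∈ ω := by
    rw [← mul_one b, ← smul_eq_mul, map_smul, Submodule.coe_smul, smul_eq_mul, mul_one,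
      Algebra.smul_def, Algebra.smul_def] at h
    rw [← mul_left_cancel₀ (by simpa using hb0) h]
    exact (χ 1).2
  have hφ : ¬ ∃ φ : R →ₗ[R] ω, φ ∘ₗ (maximalIdeal R).subtype = mulRight f hf := fun ⟨φ, hφ⟩ =>
    hfω (mem_of_extension φ f (congrArg Subtype.val (LinearMap.congr_fun hφ ⟨b, hb⟩)))
  obtain ⟨r, ψ, hψ⟩ := exists_extension_sub_smul e hφ (mulRight g hg)
  refine ⟨r, mem_of_extension ψ _ ?_⟩
  calc (ψ b : K) = b • g - r • b • f :=
        congrArg Subtype.val (LinearMap.congr_fun hψ ⟨b, hb⟩)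
    _ = b • (g - r • f) := by rw [smul_sub, smul_comm]

theorem wcovBy_colon (hω : IsCanonicalModule R ω) (hdim : ringKrullDim R = 1) (h : A ⩿ B) :
    ω / B ⩿ ω / A := by
  refine ⟨colon_le_colon_left ω h.le, fun C hBC hCA => hCA.not_ge fun g hg => ?_⟩
  obtain ⟨b, hb, rfl⟩ := exists_eq_sup_span_singleton_of_wcovBy h
  have socle : ∀ z ∈ ω / A, ∀ a ∈ maximalIdeal R, a • (z * b) ∈ ω := fun z hz a ha => by
    rw [← mul_smul_comm]
    exact Submodule.mem_div_iff_forall_mul_mem.1 hz _ (hb a ha)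
  have mem_iff : ∀ z ∈ ω / A, z ∈ ω / (A ⊔ Submodule.span R {b}) ↔ z * b ∈ ω := fun z hz => by
    rw [colon_sup, Submodule.mem_inf, and_iff_right hz, mem_colon_span_singleton]
  obtain ⟨f, hfC, hfB⟩ := SetLike.exists_of_lt hBC
  have hf := hCA.le hfC
  rw [mem_iff f hf] at hfB
  obtain ⟨r, hr⟩ := hω.exists_sub_smul_mem hdim (socle f hf) (socle g hg) hfB
  rw [← smul_mul_assoc, ← sub_mul, ← mem_iff _ (sub_mem hg (Submodule.smul_mem _ r hf))] at hr
  simpa only [sub_add_cancel] using add_mem (hBC.le hr) (C.smul_mem r hfC)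

theorem colon_colon_eq_of_reflTransGen (hω : IsCanonicalModule R ω) (hdim : ringKrullDim R = 1)
    (h : Relation.ReflTransGen (· ⩿ ·) A B) (hA : ω / (ω / A) = A) : ω / (ω / B) = B := by
  induction h with
  | refl => exact hA
  | @tail B C _ hBC hB =>
    have hBC' := hω.wcovBy_colon hdim (hω.wcovBy_colon hdim hBC)
    rw [hB] at hBC'
    obtain rfl | h := hBC'.eq_or_eq hBC.le (le_colon_colon ω C)
    · exact hB
    · exact h.symm

theorem isDualizing [IsDomain R] [IsNoetherianRing R] (hω : IsCanonicalModule R ω)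
    (hdim : ringKrullDim R = 1) (hω0 : ω ≠ ⊥) : IsDualizing ω := by
  intro A hA0 hA
  have : Ring.KrullDimLE 1 R := Ring.krullDimLE_iff.2 hdim.le
  obtain ⟨s, hs0, hsA⟩ := exists_span_singleton_mul_le (Module.Finite.iff_fg.1 hω.finite) hA0
  have hsK : algebraMap R K s ≠ 0 := by simpa using hs0
  have hsω : Submodule.span R {algebraMap R K s} * ω ≠ ⊥ :=
    mul_ne_zero (by simpa using hsK) hω0
  obtain ⟨n, hn⟩ := exists_maximalIdeal_pow_smul_le hA hsω
  refine hω.colon_colon_eq_of_reflTransGen hdim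
    (reflTransGen_wcovBy_of_maximalIdeal_pow_smul_le hA hsA hn) ?_
  obtain ⟨U, hU⟩ := isUnit_span_singleton R hsK
  rw [← hU, colon_units_mul, colon_units_mul, inv_inv, colon_self_colon_self]

end IsCanonicalModule

end CanonicalModule

section Reduction

variable {R : Type*} [CommRing R] {I : Ideal R} {x : R} {n ν : ℕ}

/-- The element `x` of `I` generates a reduction of `I` with `I ^ (ν + 1) = x I ^ ν`; the reduction
exponent of `I` is the least `ν` for which some `x` does so. -/
structure IsPrincipalReduction (I : Ideal R) (x : R) (ν : ℕ) : Prop where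
  mem : x ∈ I
  pow_succ : I ^ (ν + 1) = Ideal.span {x} * I ^ ν

namespace IsPrincipalReduction

theorem mono (h : IsPrincipalReduction I x ν) (hn : ν ≤ n) : IsPrincipalReduction I x n := by
  refine ⟨h.mem, ?_⟩
  obtain ⟨k, rfl⟩ := Nat.exists_eq_add_of_le hn
  rw [add_right_comm, pow_add, h.pow_succ, mul_assoc, ← pow_add]

theorem ne_zero [IsDomain R] (h : IsPrincipalReduction I x ν) (hI : I ≠ ⊥) : x ≠ 0 := by
  rintro rfl
  refine pow_ne_zero (ν + 1) hI ?_
  rw [h.pow_succ, Ideal.span_singleton_zero, Ideal.bot_mul, Ideal.zero_eq_bot]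

end IsPrincipalReduction

variable {K : Type*} [Field K] [Algebra R K]

theorem coeSubmodule_pow (K : Type*) [Field K] [Algebra R K] (I : Ideal R) (n : ℕ) :
    coeSubmodule K (I ^ n) = coeSubmodule K I ^ n := by
  induction n with
  | zero => rw [pow_zero, pow_zero, Ideal.one_eq_top, IsLocalization.coeSubmodule_top]
  | succ n ih => rw [pow_succ, pow_succ, IsLocalization.coeSubmodule_mul, ih]

/-- The fractional ideal `x⁻¹ I`. If `0 ≠ x ∈ I`, its powers form an increasing chain, which
stabilizes if and only if `x` generates a reduction of `I`. For `x = 0` it is zero. -/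
def dividedIdeal (K : Type*) [Field K] [Algebra R K] (I : Ideal R) (x : R) : Submodule R K :=
  Submodule.span R {(algebraMap R K x)⁻¹} * coeSubmodule K I

namespace dividedIdeal

theorem le_iff {S : Submodule R K} :
    dividedIdeal K I x ≤ S ↔ ∀ y ∈ I, (algebraMap R K x)⁻¹ * algebraMap R K y ∈ S := by
  rw [dividedIdeal, span_singleton_mul_le_iff]
  simp only [IsLocalization.mem_coeSubmodule, forall_exists_index, and_imp,
    forall_apply_eq_imp_iff₂]

variable [FaithfulSMul R K]

theorem one_le (hx : x ∈ I) (hx0 : x ≠ 0) : 1 ≤ dividedIdeal K I x := by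
  have hX : algebraMap R K x ≠ 0 := by simpa using hx0
  rw [Submodule.one_le, ← inv_mul_cancel₀ hX]
  exact Submodule.mul_mem_mul (Submodule.mem_span_singleton_self _)
    ((IsLocalization.mem_coeSubmodule K I).2 ⟨x, hx, rfl⟩)

theorem coeSubmodule_pow_eq (hx0 : x ≠ 0) (n : ℕ) :
    coeSubmodule K (I ^ n) = Submodule.span R {algebraMap R K x} ^ n * dividedIdeal K I x ^ n := by
  rw [coeSubmodule_pow, ← mul_pow, dividedIdeal, ← mul_assoc,
    span_singleton_mul_span_singleton_inv R (by simpa using hx0), one_mul]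

theorem colon_self_eq (hx0 : x ≠ 0) (n : ℕ) :
    coeSubmodule K (I ^ n) / coeSubmodule K (I ^ n) =
      dividedIdeal K I x ^ n / dividedIdeal K I x ^ n := by
  have hX : IsUnit (Submodule.span R {algebraMap R K x}) :=
    isUnit_span_singleton R (by simpa using hx0)
  rw [coeSubmodule_pow_eq hx0, mul_colon_mul_of_isUnit (hX.pow n)]

end dividedIdeal

theorem isPrincipalReduction_iff [IsFractionRing R K] (hx : x ∈ I) (hx0 : x ≠ 0) :
    IsPrincipalReduction I x ν ↔ dividedIdeal K I x ^ (ν + 1) = dividedIdeal K I x ^ ν := by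
  have hX : IsUnit (Submodule.span R {algebraMap R K x}) :=
    isUnit_span_singleton R (by simpa using hx0)
  calc IsPrincipalReduction I x ν
      ↔ coeSubmodule K (I ^ (ν + 1)) = coeSubmodule K (Ideal.span {x} * I ^ ν) :=
        ⟨fun h => congrArg _ h.pow_succ,
          fun h => ⟨hx, IsFractionRing.coeSubmodule_injective R K h⟩⟩
    _ ↔ Submodule.span R {algebraMap R K x} ^ (ν + 1) * dividedIdeal K I x ^ (ν + 1) =
          Submodule.span R {algebraMap R K x} ^ (ν + 1) * dividedIdeal K I x ^ ν := by
        rw [IsLocalization.coeSubmodule_mul, IsLocalization.coeSubmodule_span_singleton,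
          dividedIdeal.coeSubmodule_pow_eq hx0, dividedIdeal.coeSubmodule_pow_eq hx0, ← mul_assoc,
          ← pow_succ']
    _ ↔ dividedIdeal K I x ^ (ν + 1) = dividedIdeal K I x ^ ν := (hX.pow _).mul_right_inj

end Reduction

theorem exists_forall_algebraMap_dvd {R : Type*} (S : Type*) [CommRing R] [CommRing S] [IsDomain S]
    [ValuationRing S] [Algebra R S] {I : Ideal R} (hI : I.FG) :
    ∃ x ∈ I, ∀ y ∈ I, algebraMap R S x ∣ algebraMap R S y := by
  induction I, hI using Submodule.fg_induction with
  | singleton x =>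
    refine ⟨x, Submodule.mem_span_singleton_self x, fun y hy => ?_⟩
    exact map_dvd _ (Ideal.mem_span_singleton.1 hy)
  | sup I J _ _ hI hJ =>
    obtain ⟨x, hx, hxI⟩ := hI
    obtain ⟨y, hy, hyJ⟩ := hJ
    have dvd_sup {w : R} (hwx : algebraMap R S w ∣ algebraMap R S x)
        (hwy : algebraMap R S w ∣ algebraMap R S y) :
        ∀ z ∈ I ⊔ J, algebraMap R S w ∣ algebraMap R S z := fun z hz => by
      obtain ⟨a, ha, b, hb, rfl⟩ := Submodule.mem_sup.1 hz
      rw [map_add]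
      exact dvd_add (hwx.trans (hxI a ha)) (hwy.trans (hyJ b hb))
    obtain hxy | hyx := ValuationRing.dvd_total (algebraMap R S x) (algebraMap R S y)
    · exact ⟨x, Submodule.mem_sup_left hx, dvd_sup dvd_rfl hxy⟩
    · exact ⟨y, Submodule.mem_sup_right hy, dvd_sup hyx dvd_rfl⟩

section Blowup

variable {R K : Type*} [CommRing R] [Field K] [Algebra R K] [IsFractionRing R K]
  {I : Ideal R} {x : R} {ν n : ℕ} {ω : Submodule R K}

namespace IsPrincipalReduction

theorem dividedIdeal_pow_eq (h : IsPrincipalReduction I x ν) (hx0 : x ≠ 0) (hn : ν ≤ n) :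
    dividedIdeal K I x ^ n = dividedIdeal K I x ^ ν := by
  induction n, hn using Nat.le_induction with
  | base => rfl
  | succ n hn ih => rw [(isPrincipalReduction_iff h.mem hx0).1 (h.mono hn), ih]

theorem blowup_eq (h : IsPrincipalReduction I x ν) (hx0 : x ≠ 0) :
    blowup K I = dividedIdeal K I x ^ ν := by
  have hJ : 1 ≤ dividedIdeal K I x := dividedIdeal.one_le h.mem hx0
  refine le_antisymm (iSup_le fun n => ?_) (le_iSup_of_le ν ?_) <;>
    rw [dividedIdeal.colon_self_eq hx0]
  · calc dividedIdeal K I x ^ n / dividedIdeal K I x ^ n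
        ≤ dividedIdeal K I x ^ n := colon_le_self (one_le_pow₀ hJ)
      _ ≤ dividedIdeal K I x ^ (n + ν) := pow_le_pow_right₀ hJ (Nat.le_add_right n ν)
      _ = dividedIdeal K I x ^ ν := h.dividedIdeal_pow_eq hx0 (Nat.le_add_left ν n)
  · rw [Submodule.le_div_iff_mul_le, ← pow_add]
    exact (h.dividedIdeal_pow_eq hx0 (Nat.le_add_left ν ν)).le

theorem one_le_blowup (h : IsPrincipalReduction I x ν) (hx0 : x ≠ 0) : 1 ≤ blowup K I :=
  (one_le_pow₀ (dividedIdeal.one_le h.mem hx0)).trans_eq (h.blowup_eq hx0).symm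

theorem blowup_mul_self_le (h : IsPrincipalReduction I x ν) (hx0 : x ≠ 0) :
    blowup K I * blowup K I ≤ blowup K I := by
  rw [h.blowup_eq hx0, ← pow_add, h.dividedIdeal_pow_eq hx0 (Nat.le_add_left ν ν)]

theorem blowup_fg [IsNoetherianRing R] (h : IsPrincipalReduction I x ν) (hx0 : x ≠ 0) :
    (blowup K I).FG := by
  rw [h.blowup_eq hx0]
  exact ((Submodule.fg_span_singleton _).mul
    ((IsNoetherian.noetherian I).map (Algebra.linearMap R K))).pow ν

theorem coeSubmodule_pow_eq (h : IsPrincipalReduction I x ν) (hx0 : x ≠ 0) (hn : ν ≤ n) :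
    coeSubmodule K (I ^ n) = Submodule.span R {algebraMap R K x} ^ n * blowup K I := by
  rw [dividedIdeal.coeSubmodule_pow_eq hx0, h.dividedIdeal_pow_eq hx0 hn, h.blowup_eq hx0]

theorem mul_coeSubmodule_pow_eq_iff (h : IsPrincipalReduction I x ν) (hx0 : x ≠ 0) (hn : ν ≤ n) :
    ω * coeSubmodule K (I ^ n) = coeSubmodule K (I ^ n) ↔ ω * blowup K I = blowup K I := by
  have hX : IsUnit (Submodule.span R {algebraMap R K x}) :=
    isUnit_span_singleton R (by simpa using hx0)
  rw [h.coeSubmodule_pow_eq hx0 hn, mul_left_comm, (hX.pow n).mul_right_inj]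

end IsPrincipalReduction

theorem exists_isPrincipalReduction [IsNoetherianRing R] (S : Subalgebra R K) [ValuationRing S]
    [Module.Finite R S] (I : Ideal R) : ∃ ν x, IsPrincipalReduction I x ν := by
  obtain rfl | hI := eq_or_ne I ⊥
  · exact ⟨0, 0, zero_mem _, by simp⟩
  obtain ⟨x, hx, hdvd⟩ := exists_forall_algebraMap_dvd S (IsNoetherian.noetherian I)
  have hx0 : x ≠ 0 := by
    rintro rfl
    refine hI (eq_bot_iff.2 fun y hy => ?_)
    have hy0 : algebraMap R S y = 0 := by simpa using hdvd y hy
    simpa using congrArg Subtype.val hy0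
  have hJS : dividedIdeal K I x ≤ Subalgebra.toSubmodule S := dividedIdeal.le_iff.2 fun y hy => by
    obtain ⟨s, hs⟩ := hdvd y hy
    have hs : algebraMap R K y = algebraMap R K x * s := congrArg Subtype.val hs
    rw [hs, inv_mul_cancel_left₀ (by simpa using hx0)]
    exact s.2
  have hJpow (n : ℕ) : dividedIdeal K I x ^ n ≤ Subalgebra.toSubmodule S := by
    induction n with
    | zero => exact Submodule.one_le.2 S.one_mem
    | succ n ih =>
      rw [pow_succ]
      exact (mul_le_mul' ih hJS).trans_eq S.isIdempotentElem_toSubmodule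
  have hmono : Monotone (dividedIdeal K I x ^ ·) := pow_right_mono₀ (dividedIdeal.one_le hx hx0)
  have hfg : (⨆ n, dividedIdeal K I x ^ n).FG :=
    Submodule.FG.of_le (Module.Finite.iff_fg.1 ‹_›) (iSup_le hJpow)
  obtain ⟨ν, hν⟩ := hfg.stabilizes_of_iSup_eq ⟨_, hmono⟩ rfl
  refine ⟨ν, x, (isPrincipalReduction_iff hx hx0).2 (le_antisymm ?_ (hmono ν.le_succ))⟩
  exact (le_iSup (dividedIdeal K I x ^ ·) (ν + 1)).trans_eq hν

theorem exists_isPrincipalReduction_reductionExponent [IsNoetherianRing R] (S : Subalgebra R K)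
    [ValuationRing S] [Module.Finite R S] (I : Ideal R) :
    ∃ x, IsPrincipalReduction I x (reductionExponent I) := by
  obtain ⟨ν, x, hν⟩ := exists_isPrincipalReduction S I
  obtain ⟨y, hy, hpow⟩ := Nat.sInf_mem
    (s := {m | ∃ x ∈ I, ∀ n ≥ m, I ^ (n + 1) = Ideal.span {x} * I ^ n})
    ⟨ν, x, hν.mem, fun n hn => (hν.mono hn).pow_succ⟩
  exact ⟨y, hy, hpow _ le_rfl⟩

end Blowup

section CanonicalClosure

variable {R K : Type*} [CommRing R] [Field K] [Algebra R K] {ω : Submodule R K}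

theorem coeSubmodule_canonicalClosure (ω : Submodule R K) (J : Ideal R) :
    coeSubmodule K (canonicalClosure K ω J) = 1 ⊓ coeSubmodule K J * ω := by
  rw [canonicalClosure, IsLocalization.coeSubmodule, Submodule.map_comap_eq, Submodule.one_eq_range]

theorem canonicalClosure_eq_self [IsFractionRing R K] {J : Ideal R}
    (h : ω * coeSubmodule K J = coeSubmodule K J) : canonicalClosure K ω J = J := by
  apply IsFractionRing.coeSubmodule_injective R K
  rw [coeSubmodule_canonicalClosure, mul_comm, h, inf_eq_right, ← IsLocalization.coeSubmodule_top]
  exact IsLocalization.coeSubmodule_mono K le_top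

theorem mul_coeSubmodule_pow_add_eq {I : Ideal R} {n : ℕ}
    (h : ω * coeSubmodule K (I ^ n) = coeSubmodule K (I ^ n)) (m : ℕ) :
    ω * coeSubmodule K (I ^ (n + m)) = coeSubmodule K (I ^ (n + m)) := by
  rw [pow_add, IsLocalization.coeSubmodule_mul, ← mul_assoc, h]

variable [IsFractionRing R K] {I : Ideal R} {x : R} {n ν : ℕ}

theorem IsPrincipalReduction.le_blowup_of_eq_canonicalClosure (h : IsPrincipalReduction I x ν)
    (hx0 : x ≠ 0) (hn : ν ≤ n) (hω : Submodule.span R {algebraMap R K x} ^ n * ω ≤ 1)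
    (hclosed : I ^ n = canonicalClosure K ω (I ^ n)) : ω ≤ blowup K I := by
  have hX : IsUnit (Submodule.span R {algebraMap R K x}) :=
    isUnit_span_singleton R (by simpa using hx0)
  refine (hX.pow n).mul_le_mul_left.1 ?_
  rw [← h.coeSubmodule_pow_eq hx0 hn, hclosed, coeSubmodule_canonicalClosure]
  refine le_inf hω (mul_le_mul_left ?_ ω)
  rw [h.coeSubmodule_pow_eq hx0 hn]
  exact le_mul_of_one_le_right' (h.one_le_blowup hx0)

theorem exists_span_singleton_pow_mul_le_one [IsDomain R] [IsLocalRing R] [IsNoetherianRing R]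
    [Ring.KrullDimLE 1 R] (hω : ω.FG) (hx : x ∈ maximalIdeal R) :
    ∃ N, ∀ n ≥ N, Submodule.span R {algebraMap R K x} ^ n * ω ≤ 1 := by
  obtain ⟨N, hN⟩ := exists_maximalIdeal_pow_smul_le hω (one_ne_zero (α := Submodule R K))
  refine ⟨N, fun n hn => ?_⟩
  rw [Submodule.span_pow, Set.singleton_pow, span_singleton_mul_le_iff]
  intro z hz
  rw [← map_pow, ← Algebra.smul_def]
  exact hN (Submodule.smul_mem_smul (Ideal.pow_le_pow_right hn (Ideal.pow_mem_pow hx n)) hz)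

end CanonicalClosure

theorem proposition2p1_general {R K : Type u} [CommRing R] [IsDomain R] [IsLocalRing R]
    [IsNoetherianRing R] (hdim : ringKrullDim R = 1) [Field K] [Algebra R K] [IsFractionRing R K]
    {ω : Submodule R K} (hω : IsCanonicalModule R ω) (hRω : 1 ≤ ω) {I : Ideal R}
    (hrad : I.radical = maximalIdeal R) {x : R} {ν : ℕ} (hred : IsPrincipalReduction I x ν) :
    [ω ≤ blowup K I,
      ω * blowup K I = blowup K I,
      ω / blowup K I = 1 / blowup K I,
      ∀ n ≥ ν, I ^ n = canonicalClosure K ω (I ^ n),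
      ∀ n ≥ ν, ω * coeSubmodule K (I ^ n) = coeSubmodule K (I ^ n),
      ∃ n > 0, ω * coeSubmodule K (I ^ n) = coeSubmodule K (I ^ n)].TFAE ∧
    (blowup K I = 1 / (1 / blowup K I) ↔ ω / blowup K I = ω * (1 / blowup K I)) ∧
    (ω ≤ blowup K I ↔
      (blowup K I = 1 / (1 / blowup K I) ∧ ω / blowup K I = ω * (1 / blowup K I)) ∧
        1 / blowup K I ≤ 1 / ω) := by
  have : Ring.KrullDimLE 1 R := Ring.krullDimLE_iff.2 hdim.le
  have hI0 : I ≠ ⊥ := by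
    rintro rfl
    rw [Ideal.radical_bot_of_isReduced] at hrad
    exact maximalIdeal_ne_bot_of_ringKrullDim_eq_one hdim hrad.symm
  have hx0 : x ≠ 0 := hred.ne_zero hI0
  have hω0 : ω ≠ ⊥ := ne_bot_of_le_ne_bot one_ne_zero hRω
  have hωfg : ω.FG := Module.Finite.iff_fg.1 hω.finite
  have hdual : IsDualizing ω := hω.isDualizing hdim hω0
  have h1Λ : 1 ≤ blowup K I := hred.one_le_blowup hx0
  have hΛΛ : blowup K I * blowup K I ≤ blowup K I := hred.blowup_mul_self_le hx0
  have hΛ : (blowup K I).FG := hred.blowup_fg hx0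
  have hB := hdual.eq_one_colon_one_colon_iff hωfg hω0 hΛ (ne_bot_of_le_ne_bot one_ne_zero h1Λ)
  refine ⟨?_, hB, ?_⟩
  · tfae_have 1 ↔ 2 := le_iff_mul_eq_self hRω h1Λ hΛΛ
    tfae_have 1 ↔ 3 := hdual.le_iff_colon_eq_one_colon hRω hΛ h1Λ hΛΛ
    tfae_have 2 → 5 := fun h n hn => (hred.mul_coeSubmodule_pow_eq_iff hx0 hn).2 h
    tfae_have 5 → 4 := fun h n hn => (canonicalClosure_eq_self (h n hn)).symm
    tfae_have 4 → 1 := fun h => by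
      obtain ⟨N, hN⟩ := exists_span_singleton_pow_mul_le_one hωfg
        (hrad ▸ Ideal.le_radical hred.mem)
      exact hred.le_blowup_of_eq_canonicalClosure hx0 (le_max_left ν N)
        (hN _ (le_max_right ν N)) (h _ (le_max_left ν N))
    tfae_have 5 → 6 := fun h => ⟨ν + 1, ν.succ_pos, h _ ν.le_succ⟩
    tfae_have 6 → 2 := fun ⟨n, _, h⟩ =>
      (hred.mul_coeSubmodule_pow_eq_iff hx0 (Nat.le_add_left ν n)).1
        (mul_coeSubmodule_pow_add_eq h ν)
    tfae_finish
  · rw [and_iff_left_of_imp hB.1]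
    exact hdual.le_iff_eq_one_colon_one_colon_and_le hRω hΛ h1Λ hΛΛ

theorem proposition2p1 {R K : Type u} [CommRing R] [IsDomain R] [IsLocalRing R]
    [IsNoetherianRing R] (hdim : ringKrullDim R = 1) (hk : Infinite (IsLocalRing.ResidueField R))
    [Field K] [Algebra R K] [IsFractionRing R K]
    (hfin : Module.Finite R (integralClosure R K))
    [IsDiscreteValuationRing (integralClosure R K)]
    (hres : IsResiduallyRational R (integralClosure R K))
    (ω : Submodule R K) (hω : IsCanonicalModule R ω)
    (hRω : 1 ≤ ω) (hωR : ω ≤ Subalgebra.toSubmodule (integralClosure R K))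
    (I : Ideal R) (hI : I.IsPrimary) (hrad : I.radical = IsLocalRing.maximalIdeal R)
    (hnp : ¬ I.IsPrincipal)
    (Λ : Submodule R K) (hΛ : Λ = blowup K I) (ν : ℕ) (hν : ν = reductionExponent I) :
    -- the conditions (A) are equivalent
    [ω ≤ Λ,
      ω * Λ = Λ,
      ω / Λ = 1 / Λ,
      ∀ n ≥ ν, I ^ n = canonicalClosure K ω (I ^ n),
      ∀ n ≥ ν, ω * IsLocalization.coeSubmodule K (I ^ n) =
        IsLocalization.coeSubmodule K (I ^ n),
      ∃ n > 0, ω * IsLocalization.coeSubmodule K (I ^ n) =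
        IsLocalization.coeSubmodule K (I ^ n)].TFAE ∧
    -- the conditions (B) are equivalent
    (Λ = 1 / (1 / Λ) ↔ ω / Λ = ω * (1 / Λ)) ∧
    -- (A) holds if and only if (B) holds and `R : Λ ⊆ R : ω`
    (ω ≤ Λ ↔ (Λ = 1 / (1 / Λ) ∧ ω / Λ = ω * (1 / Λ)) ∧ 1 / Λ ≤ 1 / ω) := by
  obtain ⟨x, hx⟩ := exists_isPrincipalReduction_reductionExponent (integralClosure R K) I
  subst hΛ hν
  exact proposition2p1_general hdim hω hRω hrad hx
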